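/- Consider the trivial bundle $\pi\colon\mathbb{R}\times\mathbb{R}\to\mathbb{R}$ with base coordinate $x$ and fibre coordinate $u$. A differential function is a smooth function of $x$ and finitely many of the jet coordinates $u_0=u,\ u_1=u_x,\ u_2=u_{xx},\dots$. Let $\xi=\xi_0,\ \xi_1=\xi_x,\ \xi_2,\dots$ be anticommuting (parity-odd) variables, and let $\mathrm{d}/\mathrm{d}x$ be the total derivative, with $u_k\mapsto u_{k+1}$ and $\xi_k\mapsto\xi_{k+1}$. A variational multivector $\langle F\rangle$ is represented by a density $F$, that is, a polynomial in the $\xi_k$ whose coefficients are differential functions. Two densities are cohomologous, $F\cong G$, if $F-G=\frac{\mathrm{d}}{\mathrm{d}x}\eta$ for some density $\eta$. With $\frac{\delta}{\delta u}=\sum_k(-\frac{\mathrm{d}}{\mathrm{d}x})^k\frac{\partial}{\partial u_k}$ and $\frac{\delta}{\delta\xi}=\sum_k(-\frac{\mathrm{d}}{\mathrm{d}x})^k\frac{\partial}{\partial\xi_k}$, the variational Schouten bracket is $[\![F,G]\!]=(F)\frac{\overleftarrow{\delta}}{\delta u}\cdot\frac{\overrightarrow{\delta}}{\delta\xi}(G)-(F)\frac{\overleftarrow{\delta}}{\delta\xi}\cdot\frac{\overrightarrow{\delta}}{\delta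 u}(G)$. A total differential operator $A$ determines the variational bi-vector $\frac12\langle\xi\cdot A(\xi)\rangle$; it is Hamiltonian if it is skew-adjoint and its bi-vector $P$ satisfies $[\![P,P]\!]\cong0$. For a bi-vector density $P$ put $P^{ab}=\frac{\overrightarrow\partial}{\partial\xi_b}\frac{\overrightarrow\partial}{\partial\xi_a}P$, so that $P=\frac12\sum_{a,b}P^{ab}\xi_a\xi_b$. The tetrahedral flows are $$\Gamma_1(P)=\tfrac12\sum \partial_k\partial_\ell\partial_m P^{ij}\;\partial_{\ell'}P^{kk'}\;\partial_{m'}P^{\ell\ell'}\;\partial_{k'}P^{mm'}\;\xi_i\xi_j,$$ $$\Gamma_2(P)=\tfrac12\sum \partial_k\partial_\ell P^{ij}\;\partial_{k'}\partial_{\ell'}P^{km}\;\partial_{m'}P^{k'\ell}\;\partial_{j}P^{m'\ell'}\;\xi_i\xi_m.$$ Here each index that occurs in a $\partial$ is a pair $e=(\tau_e,\sigma_e)$ of non-negative integers, of which only $\tau_e$ is used as an upper index of $P$; the indices of the final $\xi$'s are single non-negative integers; and $\partial_{e_1}\cdots\partial_{e_r}P^{ab}$ stands for $(-1)^{\sigma_{e_1}+\dots+\sigma_{e_r}}\bigl(\frac{\mathrm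 d}{\mathrm dx}\bigr)^{\sum_s(\tau_{e_s}+\sigma_{e_s})}\frac{\partial^r P^{ab}}{\partial u_{\sigma_{e_1}}\cdots\partial u_{\sigma_{e_r}}}$. The sums run over all the indices and have finitely many nonzero terms. Theorem (the twelfth counterexample). The operator $A=u^2\circ\frac{\mathrm d}{\mathrm dx}\circ u^2$ of the Harry Dym equation is Hamiltonian. Put $P_0=\frac12\langle\xi\cdot A(\xi)\rangle$, $P_1=\Gamma_1(P_0)$ and $P_2=\Gamma_2(P_0)$, where the flows are evaluated at the density $\frac12\,\xi\cdot A(\xi)$. Then 1. $P_1=\frac12\langle\xi\cdot A_1(\xi)\rangle$ with $A_1=192\,(9u^8u_xu_{xx}-u^9u_{xxx})\,\frac{\mathrm d}{\mathrm dx}$ (an equality of densities); 2. $[\![P_0,P_1]\!]\not\cong0$; 3. $P_2\cong0$. -/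

import Mathlib

open scoped ContDiff TensorProduct

noncomputable section

namespace HarryDym

/-! ### Differential functions on the infinite jet space of `ℝ × ℝ → ℝ` -/

/-- The infinite jet space of the trivial bundle `ℝ × ℝ → ℝ`; a point is `(x, (u, u_x, u_xx, …))`. -/
abbrev Jet : Type := ℝ × (ℕ → ℝ)

/-- The projection onto the jets of order `< n`. -/
def proj (n : ℕ) : Jet →ₗ[ℝ] ℝ × (Fin n → ℝ) where
  toFun p := (p.1, fun i => p.2 i)
  map_add' _ _ := rfl
  map_smul' _ _ := rfl

/-- A differential function: smooth, and depending on finitely many jet coordinates only. -/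
def IsLocal (f : Jet → ℝ) : Prop :=
  ∃ (n : ℕ) (g : ℝ × (Fin n → ℝ) → ℝ), ContDiff ℝ ∞ g ∧ ∀ p, f p = g (proj n p)

/-- Restriction of jets of order `< n` to jets of order `< m`. -/
def trunc {m n : ℕ} (h : m ≤ n) (q : ℝ × (Fin n → ℝ)) : ℝ × (Fin m → ℝ) :=
  (q.1, fun i => q.2 (Fin.castLE h i))

lemma contDiff_trunc {m n : ℕ} (h : m ≤ n) : ContDiff ℝ ∞ (trunc h) := by
  unfold trunc; fun_prop

lemma IsLocal.lift {f : Jet → ℝ} (hf : IsLocal f) :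
    ∃ N : ℕ, ∀ n, N ≤ n → ∃ g : ℝ × (Fin n → ℝ) → ℝ, ContDiff ℝ ∞ g ∧ ∀ p, f p = g (proj n p) := by
  obtain ⟨m, g, hg, h⟩ := hf
  exact ⟨m, fun n hn => ⟨g ∘ trunc hn, hg.comp (contDiff_trunc hn), fun p => h p⟩⟩

lemma IsLocal.common {f f' : Jet → ℝ} (hf : IsLocal f) (hf' : IsLocal f') :
    ∃ (n : ℕ) (g g' : ℝ × (Fin n → ℝ) → ℝ), ContDiff ℝ ∞ g ∧ ContDiff ℝ ∞ g' ∧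
      (∀ p, f p = g (proj n p)) ∧ ∀ p, f' p = g' (proj n p) := by
  obtain ⟨N, h⟩ := hf.lift
  obtain ⟨N', h'⟩ := hf'.lift
  obtain ⟨g, hg, e⟩ := h (max N N') (le_max_left _ _)
  obtain ⟨g', hg', e'⟩ := h' (max N N') (le_max_right _ _)
  exact ⟨_, g, g', hg, hg', e, e'⟩

/-- The differential functions as a subalgebra of all functions on the jet space. -/
def localSubalgebra : Subalgebra ℝ (Jet → ℝ) where
  carrier := {f | IsLocal f}
  mul_mem' := by
    intro f f' hf hf'
    obtain ⟨n, g, g', hg, hg', e, e'⟩ := IsLocal.common hf hf'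
    exact ⟨n, fun q => g q * g' q, hg.mul hg', fun p => by simp [e, e']⟩
  add_mem' := by
    intro f f' hf hf'
    obtain ⟨n, g, g', hg, hg', e, e'⟩ := IsLocal.common hf hf'
    exact ⟨n, fun q => g q + g' q, hg.add hg', fun p => by simp [e, e']⟩
  algebraMap_mem' := fun r => ⟨0, fun _ => r, contDiff_const, fun _ => rfl⟩

/-- The `ℝ`-algebra of differential functions. -/
def LocalFun : Type := localSubalgebra

instance : CommRing LocalFun := inferInstanceAs (CommRing localSubalgebra)

instance : Algebra ℝ LocalFun := inferInstanceAs (Algebra ℝ localSubalgebra)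

/-- A differential function as a function on the jet space. -/
def LocalFun.toFun : LocalFun →ₐ[ℝ] (Jet → ℝ) := localSubalgebra.val

lemma isLocal_sum {ι : Type*} (s : Finset ι) (f : ι → Jet → ℝ) (h : ∀ i, IsLocal (f i)) :
    IsLocal (fun p => ∑ i ∈ s, f i p) := by
  have := localSubalgebra.sum_mem (t := s) (f := f) (fun i _ => h i)
  have e : (fun p => ∑ i ∈ s, f i p) = ∑ i ∈ s, f i := by
    ext p
    simp
  rw [e]
  exact this

/-- A vector field on the jet space whose components are differential functions. -/
structure JetField where
  toFun : Jet → Jet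
  fst_local : IsLocal fun p => (toFun p).1
  snd_local : ∀ k, IsLocal fun p => (toFun p).2 k

lemma hasLineDerivAt_of_proj {f : Jet → ℝ} {n : ℕ} {g : ℝ × (Fin n → ℝ) → ℝ}
    (hg : ContDiff ℝ ∞ g) (h : ∀ p, f p = g (proj n p)) (p v : Jet) :
    HasLineDerivAt ℝ f (fderiv ℝ g (proj n p) (proj n v)) p v := by
  have hd : HasFDerivAt g (fderiv ℝ g (proj n p)) (proj n p) :=
    (hg.differentiable (by simp) _).hasFDerivAt
  have := hd.hasLineDerivAt (proj n v)
  unfold HasLineDerivAt at this ⊢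
  convert this using 2 with t
  rw [h, map_add, map_smul]

lemma IsLocal.hasLineDerivAt {f : Jet → ℝ} (hf : IsLocal f) (p v : Jet) :
    HasLineDerivAt ℝ f (lineDeriv ℝ f p v) p v := by
  obtain ⟨n, g, hg, h⟩ := hf
  exact (hasLineDerivAt_of_proj hg h p v).lineDifferentiableAt.hasLineDerivAt

lemma IsLocal.lineDeriv_eq {f : Jet → ℝ} {n : ℕ} {g : ℝ × (Fin n → ℝ) → ℝ}
    (hg : ContDiff ℝ ∞ g) (h : ∀ p, f p = g (proj n p)) (p v : Jet) :
    lineDeriv ℝ f p v = v.1 * fderiv ℝ g (proj n p) (1, 0) +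
      ∑ k : Fin n, v.2 k * fderiv ℝ g (proj n p) (0, Pi.single k 1) := by
  rw [(hasLineDerivAt_of_proj hg h p v).lineDeriv]
  have : proj n v = v.1 • ((1 : ℝ), (0 : Fin n → ℝ)) +
      ∑ k : Fin n, v.2 k • ((0 : ℝ), (Pi.single k 1 : Fin n → ℝ)) := by
    ext i
    · simp [proj, Prod.fst_sum]
    · simp [proj, Prod.snd_sum, Finset.sum_apply, Pi.single_apply]
  rw [this, map_add, map_sum]
  simp only [map_smul, smul_eq_mul]

lemma IsLocal.lineDeriv {f : Jet → ℝ} (hf : IsLocal f) (X : JetField) :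
    IsLocal fun p => lineDeriv ℝ f p (X.toFun p) := by
  obtain ⟨n, g, hg, h⟩ := hf
  have hc : ∀ w : ℝ × (Fin n → ℝ), IsLocal fun p => fderiv ℝ g (proj n p) w := fun w =>
    ⟨n, fun q => fderiv ℝ g q w, (hg.fderiv_right (m := ∞) (by simp)).clm_apply contDiff_const,
      fun _ => rfl⟩
  simp only [IsLocal.lineDeriv_eq hg h]
  exact localSubalgebra.add_mem (localSubalgebra.mul_mem X.fst_local (hc _))
    (isLocal_sum _ _ fun k => localSubalgebra.mul_mem (X.snd_local k) (hc _))

/-- The derivation of the algebra of differential functions along a vector field. -/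
def JetField.derivation (X : JetField) : Derivation ℝ LocalFun LocalFun :=
  Derivation.mk'
    { toFun := fun f => ⟨fun p => lineDeriv ℝ f.1 p (X.toFun p), IsLocal.lineDeriv f.2 X⟩
      map_add' := fun f g => Subtype.ext <| funext fun p =>
        HasLineDerivAt.lineDeriv (by
          have := HasDerivAt.add
            (IsLocal.hasLineDerivAt f.2 p (X.toFun p)) (IsLocal.hasLineDerivAt g.2 p (X.toFun p))
          exact this)
      map_smul' := fun c f => Subtype.ext <| funext fun p =>
        HasLineDerivAt.lineDeriv (by
          have := HasDerivAt.const_mul c (IsLocal.hasLineDerivAt f.2 p (X.toFun p))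
          exact this) }
    fun f g => Subtype.ext <| funext fun p =>
      HasLineDerivAt.lineDeriv (by
        have := HasDerivAt.mul
          (IsLocal.hasLineDerivAt f.2 p (X.toFun p)) (IsLocal.hasLineDerivAt g.2 p (X.toFun p))
        simp only [zero_smul, add_zero] at this
        refine this.congr_deriv ?_
        change _ = f.1 p * lineDeriv ℝ g.1 p _ + g.1 p * lineDeriv ℝ f.1 p _
        ring)

lemma isLocal_coord (k : ℕ) : IsLocal fun p => p.2 k :=
  ⟨k + 1, fun q => q.2 (Fin.last k), by fun_prop, fun _ => rfl⟩

lemma isLocal_const (c : ℝ) : IsLocal fun _ => c := ⟨0, fun _ => c, contDiff_const, fun _ => rfl⟩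

/-- The jet coordinate `u_k`, i.e. the `k`-th derivative of `u` along `x`. -/
def u (k : ℕ) : LocalFun := ⟨fun p => p.2 k, isLocal_coord k⟩

/-- The coordinate vector field `∂/∂x`. -/
def coordX : JetField where
  toFun _ := (1, 0)
  fst_local := isLocal_const 1
  snd_local _ := isLocal_const 0

/-- The coordinate vector field `∂/∂u_k`. -/
def coordU (k : ℕ) : JetField where
  toFun _ := (0, Pi.single k 1)
  fst_local := isLocal_const 0
  snd_local j := isLocal_const ((Pi.single k 1 : ℕ → ℝ) j)

/-- The Cartan vector field `∂/∂x + ∑ₖ u_{k+1} ∂/∂u_k`. -/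
def cartan : JetField where
  toFun p := (1, fun k => p.2 (k + 1))
  fst_local := isLocal_const 1
  snd_local k := isLocal_coord (k + 1)

/-- The total derivative is `∂/∂x + ∑ₖ u_{k+1} ∂/∂u_k` (a finite sum on every function). -/
lemma cartan_eq (f : LocalFun) : ∃ N : ℕ, (∀ k, N ≤ k → (coordU k).derivation f = 0) ∧
    cartan.derivation f = coordX.derivation f +
      ∑ k ∈ Finset.range N, u (k + 1) * (coordU k).derivation f := by
  obtain ⟨n, g, hg, h⟩ := f.2
  have key : ∀ (X : JetField) p, (X.derivation f).1 p = (X.toFun p).1 *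
      fderiv ℝ g (proj n p) (1, 0) + ∑ k : Fin n, (X.toFun p).2 k *
        fderiv ℝ g (proj n p) (0, Pi.single k 1) :=
    fun X p => IsLocal.lineDeriv_eq hg h p (X.toFun p)
  refine ⟨n, fun k hk => Subtype.ext <| funext fun p => ?_, Subtype.ext <| funext fun p => ?_⟩
  · rw [key]
    have : ∀ i : Fin n, (i : ℕ) ≠ k := fun i => by omega
    simp only [coordU, ne_eq, this, not_false_eq_true, Pi.single_eq_of_ne, zero_mul,
      Finset.sum_const_zero, add_zero]
    rfl
  · rw [key]
    have hs : LocalFun.toFun (coordX.derivation f + ∑ k ∈ Finset.range n,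
        u (k + 1) * (coordU k).derivation f) p =
        (coordX.derivation f).1 p +
          ∑ k ∈ Finset.range n, p.2 (k + 1) * ((coordU k).derivation f).1 p := by
      simp only [map_add, map_sum, map_mul, Pi.add_apply, Finset.sum_apply, Pi.mul_apply]
      rfl
    refine Eq.trans ?_ hs.symm
    rw [key]
    simp only [key]
    simp [cartan, coordX, coordU, Finset.sum_range, Pi.single_apply, Fin.val_inj]

/-! ### Variational multivectors: densities with parity-odd variables `ξ_k` -/

/-- The Grassmann algebra over `ℝ` on the generators `ξ₀ = ξ, ξ₁ = ξ_x, ξ₂ = ξ_xx, …`. -/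
abbrev Grassmann : Type := ExteriorAlgebra ℝ (ℕ →₀ ℝ)

/-- Densities of variational multivectors: polynomials in the odd variables `ξ_k` with
differential functions as coefficients. -/
abbrev Density : Type := LocalFun ⊗[ℝ] Grassmann

/-- The shift `ξ_k ↦ ξ_{k+1}` on the generators. -/
def shift : (ℕ →₀ ℝ) →ₗ[ℝ] (ℕ →₀ ℝ) := Finsupp.lmapDomain ℝ ℝ Nat.succ

/-- The algebra map `w ↦ w + ε w'` to the dual numbers, where `w'` is the total derivative of a
polynomial `w` in the odd variables. -/
def oddTotalDAux : Grassmann →ₐ[ℝ] DualNumber Grassmann :=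
  ExteriorAlgebra.lift ℝ
    ⟨{ toFun := fun v => TrivSqZeroExt.inl (ExteriorAlgebra.ι ℝ v) +
          TrivSqZeroExt.inr (ExteriorAlgebra.ι ℝ (shift v))
       map_add' := fun v w => by ext <;> simp
       map_smul' := fun c v => by ext <;> simp },
      fun v => by
        ext
        · simp
        · simp [ExteriorAlgebra.ι_add_mul_swap]⟩

/-- The total derivative on polynomials in the odd variables: the even derivation of the
Grassmann algebra with `ξ_k ↦ ξ_{k+1}`. -/
def oddTotalD : Grassmann →ₗ[ℝ] Grassmann where
  toFun w := (oddTotalDAux w).snd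
  map_add' _ _ := by simp
  map_smul' _ _ := by simp

lemma oddTotalDAux_fst (w : Grassmann) : (oddTotalDAux w).fst = w := by
  have : (TrivSqZeroExt.fstHom ℝ Grassmann Grassmann).comp oddTotalDAux = AlgHom.id ℝ Grassmann := by
    ext v
    simp [oddTotalDAux]
  exact DFunLike.congr_fun this w

lemma oddTotalD_ι (v : ℕ →₀ ℝ) :
    oddTotalD (ExteriorAlgebra.ι ℝ v) = ExteriorAlgebra.ι ℝ (shift v) := by
  simp [oddTotalD, oddTotalDAux]

lemma oddTotalD_mul (w z : Grassmann) :
    oddTotalD (w * z) = w * oddTotalD z + oddTotalD w * z := by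
  simp [oddTotalD, oddTotalDAux_fst]

/-- A differential function as a density of degree zero. -/
def ofFun : LocalFun →ₐ[ℝ] Density := Algebra.TensorProduct.includeLeft

/-- The odd variable `ξ_k`. -/
def ξ (k : ℕ) : Density := 1 ⊗ₜ[ℝ] ExteriorAlgebra.ι ℝ (Finsupp.single k 1)

/-- The total derivative `d/dx` on densities. -/
def totalD : Module.End ℝ Density :=
  LinearMap.rTensor Grassmann (cartan.derivation : LocalFun →ₗ[ℝ] LocalFun) +
    LinearMap.lTensor LocalFun oddTotalD

/-- The partial derivative `∂/∂u_k` on densities. -/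
def partialU (k : ℕ) : Module.End ℝ Density :=
  LinearMap.rTensor Grassmann ((coordU k).derivation : LocalFun →ₗ[ℝ] LocalFun)

/-- The left partial derivative `∂/∂ξ_k`. -/
def partialXi (k : ℕ) : Module.End ℝ Density :=
  LinearMap.lTensor LocalFun
    (CliffordAlgebra.contractLeft (Q := (0 : QuadraticForm ℝ (ℕ →₀ ℝ))) (Finsupp.lapply k))

/-- The right partial derivative `∂/∂ξ_k`. -/
def partialXiRight (k : ℕ) : Module.End ℝ Density :=
  LinearMap.lTensor LocalFun
    ((CliffordAlgebra.contractRight (Q := (0 : QuadraticForm ℝ (ℕ →₀ ℝ)))).flip (Finsupp.lapply k))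

/-- A density depends on finitely many of the variables `u_k` and `ξ_k`. -/
lemma exists_order (F : Density) :
    ∃ N : ℕ, ∀ k, N ≤ k → partialU k F = 0 ∧ partialXi k F = 0 ∧ partialXiRight k F = 0 := by
  have hG : ∀ w : Grassmann, ∃ N : ℕ, ∀ k, N ≤ k →
      CliffordAlgebra.contractLeft (Q := (0 : QuadraticForm ℝ (ℕ →₀ ℝ))) (Finsupp.lapply k) w
        = 0 := by
    intro w
    induction w using CliffordAlgebra.left_induction with
    | algebraMap r => exact ⟨0, fun k _ => by simp⟩
    | add x y hx hy =>
      obtain ⟨N, hx⟩ := hx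
      obtain ⟨M, hy⟩ := hy
      exact ⟨max N M, fun k hk => by
        rw [map_add, hx k (le_trans (le_max_left _ _) hk), hy k (le_trans (le_max_right _ _) hk),
          add_zero]⟩
    | ι_mul x m hx =>
      obtain ⟨N, hx⟩ := hx
      obtain ⟨M, hM⟩ := m.support.exists_nat_subset_range
      refine ⟨max N M, fun k hk => ?_⟩
      have : m k = 0 := by
        by_contra h
        have := Finset.mem_range.1 (hM (Finsupp.mem_support_iff.2 h))
        have := le_trans (le_max_right N M) hk
        omega
      rw [CliffordAlgebra.contractLeft_ι_mul, hx k (le_trans (le_max_left _ _) hk)]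
      simp [this]
  induction F using TensorProduct.induction_on with
  | zero => exact ⟨0, fun k _ => by simp⟩
  | add x y hx hy =>
    obtain ⟨N, hx⟩ := hx
    obtain ⟨M, hy⟩ := hy
    refine ⟨max N M, fun k hk => ?_⟩
    obtain ⟨h1, h2, h3⟩ := hx k (le_trans (le_max_left _ _) hk)
    obtain ⟨h4, h5, h6⟩ := hy k (le_trans (le_max_right _ _) hk)
    simp only [map_add, h1, h2, h3, h4, h5, h6, add_zero, and_self]
  | tmul f w =>
    obtain ⟨N, hN, -⟩ := cartan_eq f
    obtain ⟨M, hM⟩ := hG w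
    obtain ⟨L, hL⟩ := hG (CliffordAlgebra.reverse w)
    refine ⟨max N (max M L), fun k hk => ?_⟩
    simp only [max_le_iff] at hk
    have e : CliffordAlgebra.contractRight w (Finsupp.lapply k) = 0 := by
      rw [CliffordAlgebra.contractRight_eq, hL k hk.2.2, map_zero]
    refine ⟨?_, ?_, ?_⟩
    · simp [partialU, hN k hk.1]
    · simp [partialXi, hM k hk.2.1]
    · simp [partialXiRight, e]

/-- Two densities are cohomologous (represent the same variational multivector) if they differ by
a total derivative. -/
def Cohomologous (F G : Density) : Prop := ∃ η : Density, F - G = totalD η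

/-- The Euler operator `∑ₖ (-d/dx)^k ∘ ∂ₖ` of a family of partial derivatives `∂ₖ`. On every
density only finitely many terms are nonzero. -/
def euler (d : ℕ → Module.End ℝ Density) (F : Density) : Density :=
  ∑ᶠ k : ℕ, (-1 : ℝ) ^ k • (totalD ^ k) (d k F)

/-- The variational Schouten bracket
`⟨(F)δ⃖/δu · δ⃗/δξ(G) - (F)δ⃖/δξ · δ⃗/δu(G)⟩` (a density of it). -/
def schouten (F G : Density) : Density :=
  euler partialU F * euler partialXi G - euler partialXiRight F * euler partialU G

/-- The variational bivector `½⟨ξ · A(ξ)⟩` of a total differential operator `A`. -/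
def bivector (A : Module.End ℝ Density) : Density := (1 / 2 : ℝ) • (ξ 0 * A (ξ 0))

/-- The operator of multiplication by a differential function. -/
def mulOp (f : LocalFun) : Module.End ℝ Density := LinearMap.mulLeft ℝ (ofFun f)

/-- A total differential operator `A` is Hamiltonian if it is skew-adjoint and its variational
bivector satisfies the classical master equation. -/
def IsHamiltonian (A : Module.End ℝ Density) : Prop :=
  (∀ f g : LocalFun, Cohomologous (ofFun f * A (ofFun g) + A (ofFun f) * ofFun g) 0) ∧
    Cohomologous (schouten (bivector A) (bivector A)) 0

/-! ### The tetrahedral flows -/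

/-- The content of an internal vertex of a graph. The vertex carries the bivector `P`; the indices
of its outgoing edges are `a` (left) and `b` (right), which select `P^{ab} = ∂²P / ∂ξ_a ∂ξ_b`
(so that `P = ½ ∑ P^{ab} ξ_a ξ_b`).
An edge issued at a vertex and pointing to a vertex stands for the coupling of `∂/∂ξ_τ` in its tail
with the variational derivative in its head, and it is decorated by a pair `e = (τ, σ)`: the tail
contributes `(d/dx)^τ` and the head `(-d/dx)^σ ∘ ∂/∂u_σ`. For iterated variations, all the total
derivatives are applied after all the partial derivatives. The list `es` consists of the decorations
of the incoming edges. -/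
def vertex (P : Density) (a b : ℕ) (es : List (ℕ × ℕ)) : Density :=
  (es.map fun e => (-1 : ℝ) ^ e.2 • totalD ^ (e.1 + e.2)).prod
    ((es.map fun e => partialU e.2).prod (partialXi b (partialXi a P)))

/-- The first tetrahedral flow, `½ ∑ ∂ₖ∂ₗ∂ₘP^{ij} ∂_{l'}P^{kk'} ∂_{m'}P^{ll'} ∂_{k'}P^{mm'} ξᵢ ξⱼ`.
The sums are over the decorations of the edges; they have finitely many nonzero terms. -/
def flow₁ (P : Density) : Density :=
  (1 / 2 : ℝ) • ∑ᶠ (i : ℕ) (j : ℕ) (k : ℕ × ℕ) (l : ℕ × ℕ) (m : ℕ × ℕ)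
    (k' : ℕ × ℕ) (l' : ℕ × ℕ) (m' : ℕ × ℕ),
      vertex P i j [k, l, m] * vertex P k.1 k'.1 [l'] * vertex P l.1 l'.1 [m'] *
        vertex P m.1 m'.1 [k'] * (ξ i * ξ j)

/-- The second tetrahedral flow, `½ ∑ ∂ₖ∂ₗP^{ij} ∂_{k'}∂_{l'}P^{km} ∂_{m'}P^{k'l} ∂ⱼP^{m'l'} ξᵢ ξₘ`.
The sums are over the decorations of the edges; they have finitely many nonzero terms. -/
def flow₂ (P : Density) : Density :=
  (1 / 2 : ℝ) • ∑ᶠ (i : ℕ) (m : ℕ) (j : ℕ × ℕ) (k : ℕ × ℕ) (l : ℕ × ℕ)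
    (k' : ℕ × ℕ) (l' : ℕ × ℕ) (m' : ℕ × ℕ),
      vertex P i j.1 [k, l] * vertex P k.1 m [k', l'] * vertex P k'.1 l.1 [m'] *
        vertex P m'.1 l'.1 [j] * (ξ i * ξ m)

/-- The Harry Dym operator `u² ∘ d/dx ∘ u²`. -/
def harryDym : Module.End ℝ Density := mulOp (u 0 ^ 2) * totalD * mulOp (u 0 ^ 2)

end HarryDym

end

noncomputable section

namespace HarryDym

/-! ### Derivations on jet coordinates -/

/-! Since ξξ = 0, the Harry Dym density is P₀ = ½u⁴ ξξ_x. Its only components P^{ab} are ±½u⁴ at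
(a,b) = (0,1), (1,0), and they involve no derivative of u. Hence in both flows every head index σ is
0 and the two tails at each vertex carry 0 and 1 in some order, so each infinite sum collapses to 16
explicit terms (`finsum_flow₁`, `finsum_flow₂`), which are then computed (`flow₁_eq`, `flow₂_eq`).
The second flow vanishes already as a density.

The operator is skew because f·A(g) + A(f)·g is the total derivative of (u²f)(u²g). The bracket of
P₀ with itself vanishes identically, being cubic in the two odd variables ξ, ξ_x.

For the nontriviality of ⟦P₀, P₁⟧, write P₁ = g ξξ_x with g of order three. The variational
derivative δ/δξ annihilates total derivatives (`euler_partialXi_totalD`), so it is enough that it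
does not annihilate the bracket. The bracket is a combination of ξξ₁ξ₂, ξξ₁ξ₃ and ξξ₁ξ₄, the last
with coefficient c = u⁴ ∂g/∂u₃, and the coefficient of ξξ₅ in its δ/δξ is 2c
(`partialXi_partialXi_euler`). Here c = -96u¹³, which is nonzero wherever u ≠ 0. -/

lemma derivation_u (X : JetField) (k : ℕ) :
    (X.derivation (u k)).1 = fun p => (X.toFun p).2 k := by
  funext p
  have h : HasLineDerivAt ℝ (fun p : Jet => p.2 k) ((X.toFun p).2 k) p (X.toFun p) := by
    have : HasDerivAt (fun t : ℝ => p.2 k + t * (X.toFun p).2 k) (1 * (X.toFun p).2 k) 0 :=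
      ((hasDerivAt_id (0 : ℝ)).mul_const _).const_add _
    simpa [HasLineDerivAt] using this
  exact h.lineDeriv

@[simp] lemma cartan_u (k : ℕ) : cartan.derivation (u k) = u (k + 1) :=
  Subtype.ext (derivation_u cartan k)

@[simp] lemma coordU_u (j k : ℕ) :
    (coordU j).derivation (u k) = if j = k then 1 else 0 := by
  refine Subtype.ext ((derivation_u _ k).trans (funext fun p => ?_))
  by_cases h : j = k
  · subst h
    simp only [coordU, Pi.single_eq_same, if_true]
    rfl
  · simp only [coordU, if_neg h, Pi.single_eq_of_ne (Ne.symm h)]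
    rfl

/-! ### The calculus of densities -/

lemma ofFun_eq (f : LocalFun) : ofFun f = f • (1 : Density) := by
  simp [ofFun, Algebra.TensorProduct.one_def, TensorProduct.smul_tmul']

/-- Turns real scalars into differential functions, so that all coefficients can be merged in one
ring. -/
lemma real_smul_eq (r : ℝ) (F : Density) : r • F = algebraMap ℝ LocalFun r • F :=
  (algebraMap_smul LocalFun r F).symm

lemma totalD_tmul (f : LocalFun) (w : Grassmann) :
    totalD (f ⊗ₜ w) = cartan.derivation f ⊗ₜ w + f ⊗ₜ oddTotalD w := by
  simp [totalD]

/-- No signs occur: d/dx is an even derivation on both tensor factors. -/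
lemma totalD_mul (F G : Density) : totalD (F * G) = totalD F * G + F * totalD G := by
  induction F using TensorProduct.induction_on with
  | zero => simp
  | add x y hx hy => rw [add_mul, map_add, hx, hy, map_add]; noncomm_ring
  | tmul f w =>
    induction G using TensorProduct.induction_on with
    | zero => simp
    | add x y hx hy => rw [mul_add, map_add, hx, hy, map_add]; noncomm_ring
    | tmul g z =>
      simp only [Algebra.TensorProduct.tmul_mul_tmul, totalD_tmul, Derivation.leibniz,
        oddTotalD_mul, TensorProduct.add_tmul, TensorProduct.tmul_add, smul_eq_mul, add_mul,
        mul_add, mul_comm g]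
      abel

@[simp] lemma totalD_one : totalD 1 = 0 := by
  have := totalD_mul 1 1
  simpa using this

lemma totalD_ofFun (f : LocalFun) : totalD (ofFun f) = ofFun (cartan.derivation f) := by
  have h : oddTotalD 1 = 0 := by simpa using oddTotalD_mul 1 1
  simp [ofFun, totalD_tmul, h]

lemma smul_eq_ofFun_mul (f : LocalFun) (F : Density) : f • F = ofFun f * F := by
  rw [ofFun_eq, smul_mul_assoc, one_mul]

lemma totalD_smul (f : LocalFun) (F : Density) :
    totalD (f • F) = cartan.derivation f • F + f • totalD F := by
  simp only [smul_eq_ofFun_mul, totalD_mul, totalD_ofFun]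

@[simp] lemma totalD_ξ (k : ℕ) : totalD (ξ k) = ξ (k + 1) := by
  simp [ξ, totalD_tmul, oddTotalD_ι, shift, Finsupp.lmapDomain_apply, Finsupp.mapDomain_single]

lemma ξ_sq (k : ℕ) : ξ k * ξ k = 0 := by
  simp [ξ]

lemma ξ_mul_swap (j k : ℕ) : ξ j * ξ k = -(ξ k * ξ j) := by
  rw [eq_neg_iff_add_eq_zero]
  simp [ξ, ← TensorProduct.tmul_add, ExteriorAlgebra.ι_add_mul_swap]

lemma partialU_smul (k : ℕ) (f : LocalFun) (F : Density) :
    partialU k (f • F) = (coordU k).derivation f • F + f • partialU k F := by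
  induction F using TensorProduct.induction_on with
  | zero => simp
  | add x y hx hy => simp only [smul_add, map_add, hx, hy]; abel
  | tmul g w =>
    simp only [partialU, TensorProduct.smul_tmul', LinearMap.rTensor_tmul, smul_eq_mul,
      Derivation.coeFn_coe, Derivation.leibniz, TensorProduct.add_tmul]
    rw [add_comm, mul_comm g]

@[simp] lemma partialU_one (k : ℕ) : partialU k 1 = 0 := by
  simp [partialU, Algebra.TensorProduct.one_def]

@[simp] lemma partialU_ξ_mul (j k : ℕ) (F : Density) :
    partialU j (ξ k * F) = ξ k * partialU j F := by
  induction F using TensorProduct.induction_on with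
  | zero => simp
  | add x y hx hy => simp only [mul_add, map_add, hx, hy]
  | tmul g w => simp [partialU, ξ]

@[simp] lemma partialU_ξ (j k : ℕ) : partialU j (ξ k) = 0 := by
  simp [partialU, ξ]

lemma partialXi_smul (k : ℕ) (f : LocalFun) (F : Density) :
    partialXi k (f • F) = f • partialXi k F := by
  induction F using TensorProduct.induction_on with
  | zero => simp
  | add x y hx hy => simp only [smul_add, map_add, hx, hy]
  | tmul g w => simp [partialXi, TensorProduct.smul_tmul']

lemma partialXi_ξ_mul (j k : ℕ) (F : Density) :
    partialXi j (ξ k * F) = (if j = k then F else 0) - ξ k * partialXi j F := by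
  induction F using TensorProduct.induction_on with
  | zero => simp
  | add x y hx hy =>
    simp only [mul_add, map_add, hx, hy]
    split_ifs <;> abel
  | tmul g w =>
    have := CliffordAlgebra.contractLeft_ι_mul (Q := (0 : QuadraticForm ℝ (ℕ →₀ ℝ)))
      (d := Finsupp.lapply j) (Finsupp.single k 1) w
    simp only [partialXi, ξ, Algebra.TensorProduct.tmul_mul_tmul, one_mul,
      LinearMap.lTensor_tmul, ExteriorAlgebra.ι, this, TensorProduct.tmul_sub]
    by_cases h : j = k
    · simp [h]
    · simp [h]

@[simp] lemma partialXi_one (k : ℕ) : partialXi k 1 = 0 := by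
  simp [partialXi, Algebra.TensorProduct.one_def]

@[simp] lemma partialXi_ξ (j k : ℕ) : partialXi j (ξ k) = if j = k then 1 else 0 := by
  simpa using partialXi_ξ_mul j k 1

lemma partialXiRight_smul (k : ℕ) (f : LocalFun) (F : Density) :
    partialXiRight k (f • F) = f • partialXiRight k F := by
  induction F using TensorProduct.induction_on with
  | zero => simp
  | add x y hx hy => simp only [smul_add, map_add, hx, hy]
  | tmul g w => simp [partialXiRight, TensorProduct.smul_tmul']

lemma partialXiRight_mul_ξ (j k : ℕ) (F : Density) :
    partialXiRight j (F * ξ k) = (if j = k then F else 0) - partialXiRight j F * ξ k := by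
  induction F using TensorProduct.induction_on with
  | zero => simp
  | add x y hx hy =>
    simp only [add_mul, map_add, hx, hy]
    split_ifs <;> abel
  | tmul g w =>
    have := CliffordAlgebra.contractRight_mul_ι (Q := (0 : QuadraticForm ℝ (ℕ →₀ ℝ)))
      (d := Finsupp.lapply j) (Finsupp.single k 1) w
    simp only [partialXiRight, ξ, Algebra.TensorProduct.tmul_mul_tmul, mul_one,
      LinearMap.lTensor_tmul, ExteriorAlgebra.ι, LinearMap.flip_apply, this,
      TensorProduct.tmul_sub]
    by_cases h : j = k
    · simp [h]
    · simp [h]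

@[simp] lemma partialXiRight_ξ (j k : ℕ) :
    partialXiRight j (ξ k) = if j = k then 1 else 0 := by
  have h : partialXiRight j 1 = 0 := by
    simp [partialXiRight, Algebra.TensorProduct.one_def]
  simpa [h] using partialXiRight_mul_ξ j k 1

/-! ### Euler operators -/

lemma euler_eq_sum (d : ℕ → Module.End ℝ Density) (F : Density) (N : ℕ)
    (h : ∀ k, N ≤ k → d k F = 0) :
    euler d F = ∑ k ∈ Finset.range N, (-1 : ℝ) ^ k • (totalD ^ k) (d k F) := by
  refine finsum_eq_sum_of_support_subset _ fun k hk => ?_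
  by_contra hn
  exact hk (by simp [h k (by simpa using hn)])

/-- An Euler operator annihilates total derivatives. -/
lemma euler_totalD (d : ℕ → Module.End ℝ Density) (η : Density) (N : ℕ)
    (hN : ∀ k, N ≤ k → d k η = 0) (h₀ : d 0 (totalD η) = totalD (d 0 η))
    (hs : ∀ k, d (k + 1) (totalD η) = totalD (d (k + 1) η) + d k η) :
    euler d (totalD η) = 0 := by
  -- One more term than for `η` is needed: by `hs`, the derivative `d N (totalD η)` still sees `d (N
  -- - 1) η`. The partial sums telescope, leaving only a term in `d N η = 0`.
  rw [euler_eq_sum d _ (N + 1)]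
  · have key : ∀ n, ∑ k ∈ Finset.range (n + 1), (-1 : ℝ) ^ k • (totalD ^ k) (d k (totalD η)) =
        (-1 : ℝ) ^ n • (totalD ^ (n + 1)) (d n η) := by
      intro n
      induction n with
      | zero => simp [h₀]
      | succ n ih =>
        rw [Finset.sum_range_succ, ih, hs, map_add, smul_add, pow_succ totalD (n + 1),
          Module.End.mul_apply, pow_succ (-1 : ℝ)]
        simp
    rw [key, hN N le_rfl, map_zero, smul_zero]
  · intro k hk
    obtain ⟨k, rfl⟩ : ∃ m, k = m + 1 := ⟨k - 1, by omega⟩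
    rw [hs, hN _ (by omega), hN _ (by omega), map_zero, add_zero]

/-- Reduces identities between operators on densities to their behaviour under left multiplication
by one odd variable. -/
lemma density_induction {p : Density → Prop} (h1 : ∀ f : LocalFun, p (f • 1))
    (hadd : ∀ F G, p F → p G → p (F + G)) (hξ : ∀ k F, p F → p (ξ k * F)) (F : Density) :
    p F := by
  induction F using TensorProduct.induction_on with
  | zero => simpa using h1 0
  | add x y hx hy => exact hadd _ _ hx hy
  | tmul f w =>
    -- `f` must vary: the real coefficient of a generator is absorbed into it.
    induction w using CliffordAlgebra.left_induction generalizing f with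
    | algebraMap r =>
      have : f ⊗ₜ[ℝ] algebraMap ℝ Grassmann r = (r • f) • (1 : Density) := by
        rw [Algebra.algebraMap_eq_smul_one, Algebra.TensorProduct.one_def,
          TensorProduct.smul_tmul', TensorProduct.tmul_smul, smul_eq_mul, mul_one,
          TensorProduct.smul_tmul']
      exact this ▸ h1 _
    | add x y hx hy => rw [TensorProduct.tmul_add]; exact hadd _ _ (hx f) (hy f)
    | ι_mul x m hx =>
      induction m using Finsupp.induction_linear with
      | zero => simpa using h1 0
      | add a b ha hb =>
        rw [map_add, add_mul, TensorProduct.tmul_add]; exact hadd _ _ ha hb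
      | single k c =>
        have : f ⊗ₜ[ℝ] (CliffordAlgebra.ι (0 : QuadraticForm ℝ (ℕ →₀ ℝ)) (Finsupp.single k c) * x) =
            ξ k * ((c • f) ⊗ₜ[ℝ] x) := by
          have hs : (Finsupp.single k c : ℕ →₀ ℝ) = c • Finsupp.single k 1 := by simp
          rw [hs, map_smul, smul_mul_assoc, TensorProduct.tmul_smul, TensorProduct.smul_tmul']
          simp [ξ, ExteriorAlgebra.ι]
        exact this ▸ hξ k _ (hx _)

/-- The commutator of ∂/∂ξ_{k+1} with d/dx is ∂/∂ξ_k, because d/dx sends ξ_k to ξ_{k+1}; for ∂/∂ξ₀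
it vanishes. These are the relations that make the Euler sum telescope. -/
lemma partialXi_totalD (F : Density) : partialXi 0 (totalD F) = totalD (partialXi 0 F) ∧
    ∀ k, partialXi (k + 1) (totalD F) = totalD (partialXi (k + 1) F) + partialXi k F := by
  induction F using density_induction with
  | h1 f => simp [totalD_smul, partialXi_smul]
  | hadd F G hF hG =>
    refine ⟨by simp only [map_add, hF.1, hG.1], fun k => ?_⟩
    simp only [map_add, hF.2, hG.2]
    abel
  | hξ j F hF =>
    refine ⟨?_, fun k => ?_⟩
    · simp only [totalD_mul, totalD_ξ, map_add, map_sub, partialXi_ξ_mul, hF.1]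
      by_cases h : 0 = j
      · simp only [h, if_true, if_neg (show j ≠ j + 1 by omega)]; abel
      · simp only [h, if_false, if_neg (show (0 : ℕ) ≠ j + 1 by omega), map_zero]; abel
    · simp only [totalD_mul, totalD_ξ, map_add, map_sub, partialXi_ξ_mul, hF.2, mul_add,
        add_left_inj]
      by_cases h : k = j
      · simp only [h, if_true, if_neg (show j + 1 ≠ j by omega), map_zero]; abel
      · by_cases h' : k + 1 = j <;> simp only [h, h', if_true, if_false, map_zero] <;> abel

lemma euler_partialXi_totalD (η : Density) : euler partialXi (totalD η) = 0 := by
  obtain ⟨N, hN⟩ := exists_order η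
  exact euler_totalD _ η N (fun k hk => (hN k hk).2.1) (partialXi_totalD η).1
    (partialXi_totalD η).2

/-! ### Reduction of the sums over decorations -/

lemma finsum_eq_sum_of_forall_notMem {ι M : Type*} [AddCommMonoid M] {f : ι → M} (s : Finset ι)
    (h : ∀ i ∉ s, f i = 0) : ∑ᶠ i, f i = ∑ i ∈ s, f i :=
  finsum_eq_sum_of_support_subset _ fun i hi => by
    by_contra hn
    exact hi (h i hn)

/-- The decorations `(0, 0)` and `(1, 0)`. -/
def decorations : Finset (ℕ × ℕ) := {(0, 0), (1, 0)}

lemma mem_decorations {e : ℕ × ℕ} : e ∈ decorations ↔ e.1 < 2 ∧ e.2 = 0 := by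
  obtain ⟨a, b⟩ := e
  simp only [decorations, Finset.mem_insert, Finset.mem_singleton, Prod.mk.injEq]
  omega

lemma sum_decorations {M : Type*} [AddCommMonoid M] (f : ℕ × ℕ → M) :
    ∑ e ∈ decorations, f e = f (0, 0) + f (1, 0) := by
  simp [decorations]

/-- The tails (i,j), (k,k'), (l,l'), (m,m') leave the four vertices in pairs, so one index of each
pair determines the other. The nested sums are collapsed from the innermost outwards. -/
lemma finsum_flow₁ {M : Type*} [AddCommMonoid M]
    (f : ℕ → ℕ → ℕ × ℕ → ℕ × ℕ → ℕ × ℕ → ℕ × ℕ → ℕ × ℕ → ℕ × ℕ → M)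
    (h : ∀ i j k l m k' l' m', f i j k l m k' l' m' ≠ 0 → i < 2 ∧ j = 1 - i ∧
      k ∈ decorations ∧ l ∈ decorations ∧ m ∈ decorations ∧
      k' = (1 - k.1, 0) ∧ l' = (1 - l.1, 0) ∧ m' = (1 - m.1, 0)) :
    ∑ᶠ (i : ℕ) (j : ℕ) (k : ℕ × ℕ) (l : ℕ × ℕ) (m : ℕ × ℕ) (k' : ℕ × ℕ) (l' : ℕ × ℕ)
      (m' : ℕ × ℕ), f i j k l m k' l' m' =
    ∑ i ∈ Finset.range 2, ∑ k ∈ decorations, ∑ l ∈ decorations, ∑ m ∈ decorations,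
      f i (1 - i) k l m (1 - k.1, 0) (1 - l.1, 0) (1 - m.1, 0) := by
  have hm' : ∀ i j k l m k' l', ∑ᶠ m', f i j k l m k' l' m' = f i j k l m k' l' (1 - m.1, 0) :=
    fun i j k l m k' l' => finsum_eq_single _ _ fun x hx => by
      by_contra hn; exact hx (h _ _ _ _ _ _ _ _ hn).2.2.2.2.2.2.2
  have hl' : ∀ i j k l m k', ∑ᶠ l', f i j k l m k' l' (1 - m.1, 0) =
      f i j k l m k' (1 - l.1, 0) (1 - m.1, 0) :=
    fun i j k l m k' => finsum_eq_single _ _ fun x hx => by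
      by_contra hn; exact hx (h _ _ _ _ _ _ _ _ hn).2.2.2.2.2.2.1
  have hk' : ∀ i j k l m, ∑ᶠ k', f i j k l m k' (1 - l.1, 0) (1 - m.1, 0) =
      f i j k l m (1 - k.1, 0) (1 - l.1, 0) (1 - m.1, 0) :=
    fun i j k l m => finsum_eq_single _ _ fun x hx => by
      by_contra hn; exact hx (h _ _ _ _ _ _ _ _ hn).2.2.2.2.2.1
  have hm : ∀ i j k l, ∑ᶠ m : ℕ × ℕ, f i j k l m (1 - k.1, 0) (1 - l.1, 0) (1 - m.1, 0) =
      ∑ m ∈ decorations, f i j k l m (1 - k.1, 0) (1 - l.1, 0) (1 - m.1, 0) :=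
    fun i j k l => finsum_eq_sum_of_forall_notMem _ fun x hx => by
      by_contra hn; exact hx (h _ _ _ _ _ _ _ _ hn).2.2.2.2.1
  have hl : ∀ i j k, ∑ᶠ l : ℕ × ℕ, ∑ m ∈ decorations,
        f i j k l m (1 - k.1, 0) (1 - l.1, 0) (1 - m.1, 0) =
      ∑ l ∈ decorations, ∑ m ∈ decorations, f i j k l m (1 - k.1, 0) (1 - l.1, 0) (1 - m.1, 0) :=
    fun i j k => finsum_eq_sum_of_forall_notMem _ fun x hx => Finset.sum_eq_zero fun _ _ => by
      by_contra hn; exact hx (h _ _ _ _ _ _ _ _ hn).2.2.2.1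
  have hk : ∀ i j, ∑ᶠ k : ℕ × ℕ, ∑ l ∈ decorations, ∑ m ∈ decorations,
        f i j k l m (1 - k.1, 0) (1 - l.1, 0) (1 - m.1, 0) =
      ∑ k ∈ decorations, ∑ l ∈ decorations, ∑ m ∈ decorations,
        f i j k l m (1 - k.1, 0) (1 - l.1, 0) (1 - m.1, 0) :=
    fun i j => finsum_eq_sum_of_forall_notMem _ fun x hx =>
      Finset.sum_eq_zero fun _ _ => Finset.sum_eq_zero fun _ _ => by
        by_contra hn; exact hx (h _ _ _ _ _ _ _ _ hn).2.2.1
  simp only [hm', hl', hk', hm, hl, hk]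
  have hj : ∀ i, ∑ᶠ j, ∑ k ∈ decorations, ∑ l ∈ decorations, ∑ m ∈ decorations,
        f i j k l m (1 - k.1, 0) (1 - l.1, 0) (1 - m.1, 0) =
      ∑ k ∈ decorations, ∑ l ∈ decorations, ∑ m ∈ decorations,
        f i (1 - i) k l m (1 - k.1, 0) (1 - l.1, 0) (1 - m.1, 0) :=
    fun i => finsum_eq_single _ _ fun x hx => Finset.sum_eq_zero fun _ _ =>
      Finset.sum_eq_zero fun _ _ => Finset.sum_eq_zero fun _ _ => by
        by_contra hn; exact hx (h _ _ _ _ _ _ _ _ hn).2.1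
  simp only [hj]
  exact finsum_eq_sum_of_forall_notMem _ fun x hx => Finset.sum_eq_zero fun _ _ =>
    Finset.sum_eq_zero fun _ _ => Finset.sum_eq_zero fun _ _ => by
      by_contra hn; exact hx (Finset.mem_range.2 (h _ _ _ _ _ _ _ _ hn).1)

/-- Here the tails leaving a common vertex are (i,j), (k,m), (k',l) and (m',l'). -/
lemma finsum_flow₂ {M : Type*} [AddCommMonoid M]
    (f : ℕ → ℕ → ℕ × ℕ → ℕ × ℕ → ℕ × ℕ → ℕ × ℕ → ℕ × ℕ → ℕ × ℕ → M)
    (h : ∀ i m j k l k' l' m', f i m j k l k' l' m' ≠ 0 → i < 2 ∧ m < 2 ∧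
      j = (1 - i, 0) ∧ k = (1 - m, 0) ∧ l ∈ decorations ∧ k' = (1 - l.1, 0) ∧
      l' ∈ decorations ∧ m' = (1 - l'.1, 0)) :
    ∑ᶠ (i : ℕ) (m : ℕ) (j : ℕ × ℕ) (k : ℕ × ℕ) (l : ℕ × ℕ) (k' : ℕ × ℕ) (l' : ℕ × ℕ)
      (m' : ℕ × ℕ), f i m j k l k' l' m' =
    ∑ i ∈ Finset.range 2, ∑ m ∈ Finset.range 2, ∑ l ∈ decorations, ∑ l' ∈ decorations,
      f i m (1 - i, 0) (1 - m, 0) l (1 - l.1, 0) l' (1 - l'.1, 0) := by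
  have hm' : ∀ i m j k l k' l', ∑ᶠ m', f i m j k l k' l' m' = f i m j k l k' l' (1 - l'.1, 0) :=
    fun i m j k l k' l' => finsum_eq_single _ _ fun x hx => by
      by_contra hn; exact hx (h _ _ _ _ _ _ _ _ hn).2.2.2.2.2.2.2
  have hl' : ∀ i m j k l k', ∑ᶠ l' : ℕ × ℕ, f i m j k l k' l' (1 - l'.1, 0) =
      ∑ l' ∈ decorations, f i m j k l k' l' (1 - l'.1, 0) :=
    fun i m j k l k' => finsum_eq_sum_of_forall_notMem _ fun x hx => by
      by_contra hn; exact hx (h _ _ _ _ _ _ _ _ hn).2.2.2.2.2.2.1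
  have hk' : ∀ i m j k l, ∑ᶠ k', ∑ l' ∈ decorations, f i m j k l k' l' (1 - l'.1, 0) =
      ∑ l' ∈ decorations, f i m j k l (1 - l.1, 0) l' (1 - l'.1, 0) :=
    fun i m j k l => finsum_eq_single _ _ fun x hx => Finset.sum_eq_zero fun _ _ => by
      by_contra hn; exact hx (h _ _ _ _ _ _ _ _ hn).2.2.2.2.2.1
  have hl : ∀ i m j k, ∑ᶠ l : ℕ × ℕ, ∑ l' ∈ decorations,
        f i m j k l (1 - l.1, 0) l' (1 - l'.1, 0) =
      ∑ l ∈ decorations, ∑ l' ∈ decorations, f i m j k l (1 - l.1, 0) l' (1 - l'.1, 0) :=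
    fun i m j k => finsum_eq_sum_of_forall_notMem _ fun x hx => Finset.sum_eq_zero fun _ _ => by
      by_contra hn; exact hx (h _ _ _ _ _ _ _ _ hn).2.2.2.2.1
  have hk : ∀ i m j, ∑ᶠ k : ℕ × ℕ, ∑ l ∈ decorations, ∑ l' ∈ decorations,
        f i m j k l (1 - l.1, 0) l' (1 - l'.1, 0) =
      ∑ l ∈ decorations, ∑ l' ∈ decorations,
        f i m j (1 - m, 0) l (1 - l.1, 0) l' (1 - l'.1, 0) :=
    fun i m j => finsum_eq_single _ _ fun x hx =>
      Finset.sum_eq_zero fun _ _ => Finset.sum_eq_zero fun _ _ => by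
        by_contra hn; exact hx (h _ _ _ _ _ _ _ _ hn).2.2.2.1
  have hj : ∀ i m, ∑ᶠ j : ℕ × ℕ, ∑ l ∈ decorations, ∑ l' ∈ decorations,
        f i m j (1 - m, 0) l (1 - l.1, 0) l' (1 - l'.1, 0) =
      ∑ l ∈ decorations, ∑ l' ∈ decorations,
        f i m (1 - i, 0) (1 - m, 0) l (1 - l.1, 0) l' (1 - l'.1, 0) :=
    fun i m => finsum_eq_single _ _ fun x hx =>
      Finset.sum_eq_zero fun _ _ => Finset.sum_eq_zero fun _ _ => by
        by_contra hn; exact hx (h _ _ _ _ _ _ _ _ hn).2.2.1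
  simp only [hm', hl', hk', hl, hk, hj]
  have hm : ∀ i, ∑ᶠ m, ∑ l ∈ decorations, ∑ l' ∈ decorations,
        f i m (1 - i, 0) (1 - m, 0) l (1 - l.1, 0) l' (1 - l'.1, 0) =
      ∑ m ∈ Finset.range 2, ∑ l ∈ decorations, ∑ l' ∈ decorations,
        f i m (1 - i, 0) (1 - m, 0) l (1 - l.1, 0) l' (1 - l'.1, 0) :=
    fun i => finsum_eq_sum_of_forall_notMem _ fun x hx => Finset.sum_eq_zero fun _ _ =>
      Finset.sum_eq_zero fun _ _ => by
        by_contra hn; exact hx (Finset.mem_range.2 (h _ _ _ _ _ _ _ _ hn).2.1)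
  simp only [hm]
  exact finsum_eq_sum_of_forall_notMem _ fun x hx => Finset.sum_eq_zero fun _ _ =>
    Finset.sum_eq_zero fun _ _ => Finset.sum_eq_zero fun _ _ => by
      by_contra hn; exact hx (Finset.mem_range.2 (h _ _ _ _ _ _ _ _ hn).1)

/-! ### The Harry Dym bivector -/

/-- The constant differential function `1 / 2`. -/
def half : LocalFun := algebraMap ℝ LocalFun (1 / 2)

/-- `ring` treats `half` as an atom; this relation is what eliminates it in the later identities. -/
lemma two_mul_half : 2 * half = 1 := by
  rw [half, ← map_ofNat (algebraMap ℝ LocalFun) 2, ← map_mul]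
  norm_num

@[simp] lemma derivation_half (X : JetField) : X.derivation half = 0 :=
  X.derivation.map_algebraMap _

@[simp] lemma derivation_ofNat (X : JetField) (n : ℕ) [n.AtLeastTwo] :
    X.derivation (ofNat(n) : LocalFun) = 0 :=
  X.derivation.map_natCast n

/-- The density `P₀ = ½ u⁴ ξ ξ_x`. -/
lemma bivector_harryDym : bivector harryDym = (half * u 0 ^ 4) • (ξ 0 * ξ 1) := by
  simp only [bivector, harryDym, Module.End.mul_apply, mulOp, LinearMap.mulLeft_apply,
    ← smul_eq_ofFun_mul, totalD_smul, totalD_ξ, mul_add, mul_smul_comm, ξ_sq,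
    smul_zero, zero_add, real_smul_eq, smul_smul, half]
  congr 1
  ring

lemma bivector_mulOp (f : LocalFun) :
    bivector (mulOp f * totalD) = (half * f) • (ξ 0 * ξ 1) := by
  simp only [bivector, Module.End.mul_apply, mulOp, LinearMap.mulLeft_apply,
    ← smul_eq_ofFun_mul, totalD_ξ, mul_smul_comm, real_smul_eq, smul_smul, half]

/-- The coefficient of `g` in `∂²(g ξ₀ ξ₁) / ∂ξ_a ∂ξ_b`. -/
def sgn (a b : ℕ) : LocalFun := if a = 0 ∧ b = 1 then 1 else if a = 1 ∧ b = 0 then -1 else 0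

lemma partialXi_partialXi (g : LocalFun) (a b : ℕ) :
    partialXi b (partialXi a (g • (ξ 0 * ξ 1))) = (sgn a b * g) • (1 : Density) := by
  simp only [partialXi_smul, partialXi_ξ_mul, partialXi_ξ, map_sub, sgn]
  by_cases h0 : a = 0
  · subst h0
    by_cases h1 : b = 1 <;> simp [h1]
  · by_cases h1 : a = 1
    · subst h1
      by_cases h1 : b = 0 <;> simp [h1]
    · simp [h0, h1]

lemma totalD_pow_smul_one (n : ℕ) (f : LocalFun) :
    (totalD ^ n) (f • (1 : Density)) = (cartan.derivation^[n] f) • (1 : Density) := by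
  induction n with
  | zero => simp
  | succ n ih =>
    rw [pow_succ', Module.End.mul_apply, ih, totalD_smul, totalD_one, smul_zero, add_zero,
      Function.iterate_succ_apply']

lemma derivation_sgn_mul (X : JetField) (a b : ℕ) (f : LocalFun) :
    X.derivation (sgn a b * f) = sgn a b * X.derivation f := by
  unfold sgn
  split_ifs <;> simp

lemma iterate_sgn_mul (a b n : ℕ) (f : LocalFun) :
    cartan.derivation^[n] (sgn a b * f) = sgn a b * cartan.derivation^[n] f := by
  induction n with
  | zero => rfl
  | succ n ih => rw [Function.iterate_succ_apply', ih, derivation_sgn_mul,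
      Function.iterate_succ_apply']

lemma coordU_monomial (k n : ℕ) (c : LocalFun) (hc : (coordU k).derivation c = 0) :
    (coordU k).derivation (c * u 0 ^ (n + 1)) = if k = 0 then (n + 1) * c * u 0 ^ n else 0 := by
  rw [Derivation.leibniz, hc, Derivation.leibniz_pow, coordU_u]
  split_ifs <;> simp
  ring

lemma sgn_ne_zero {a b : ℕ} (h : sgn a b ≠ 0) : a < 2 ∧ b < 2 ∧ a = 1 - b ∧ b = 1 - a := by
  unfold sgn at h
  split_ifs at h <;> first | omega | exact absurd rfl h

/-- A vertex of valency one evaluated at `P₀`. -/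
lemma vertex_one (a b : ℕ) (e : ℕ × ℕ) :
    vertex ((half * u 0 ^ 4) • (ξ 0 * ξ 1)) a b [e] = if e.2 = 0 then
      (sgn a b * cartan.derivation^[e.1] (4 * half * u 0 ^ 3)) • (1 : Density) else 0 := by
  obtain ⟨t, s⟩ := e
  simp only [vertex, partialXi_partialXi, List.map_cons, List.map_nil, List.prod_cons,
    List.prod_nil, mul_one, partialU_smul, partialU_one, smul_zero, add_zero,
    derivation_sgn_mul, coordU_monomial, derivation_half]
  by_cases hs : s = 0
  · subst hs
    simp only [if_true, pow_zero, one_smul, add_zero, totalD_pow_smul_one, iterate_sgn_mul]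
    norm_num
  · simp [hs]

/-- All total derivatives act after the partial ones, so their orders add up, and only ∂/∂u₀ sees
the coefficient ½u⁴. -/
lemma vertex_two (a b : ℕ) (e e' : ℕ × ℕ) :
    vertex ((half * u 0 ^ 4) • (ξ 0 * ξ 1)) a b [e, e'] = if e.2 = 0 ∧ e'.2 = 0 then
      (sgn a b * cartan.derivation^[e.1 + e'.1] (12 * half * u 0 ^ 2)) • (1 : Density) else 0 := by
  obtain ⟨t, s⟩ := e
  obtain ⟨t', s'⟩ := e'
  simp only [vertex, partialXi_partialXi, List.map_cons, List.map_nil, List.prod_cons,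
    List.prod_nil, mul_one, partialU_smul, partialU_one, smul_zero, add_zero,
    derivation_sgn_mul, coordU_monomial, derivation_half, Module.End.mul_apply]
  by_cases hs' : s' = 0
  · by_cases hs : s = 0
    · subst hs hs'
      have : (coordU 0).derivation (4 * half * u 0 ^ 3) = 12 * half * u 0 ^ 2 := by
        rw [coordU_monomial _ 2 _ (by simp)]; norm_num; ring
      norm_num [this, totalD_pow_smul_one, iterate_sgn_mul, ← Function.iterate_add_apply]
    · have : (coordU s).derivation (4 * half * u 0 ^ 3) = 0 := by
        rw [coordU_monomial _ 2 _ (by simp), if_neg hs]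
      norm_num [this, hs, hs']
  · simp [hs']

lemma vertex_three (a b : ℕ) (e e' e'' : ℕ × ℕ) :
    vertex ((half * u 0 ^ 4) • (ξ 0 * ξ 1)) a b [e, e', e''] =
      if e.2 = 0 ∧ e'.2 = 0 ∧ e''.2 = 0 then
      (sgn a b * cartan.derivation^[e.1 + e'.1 + e''.1] (24 * half * u 0)) • (1 : Density)
      else 0 := by
  obtain ⟨t, s⟩ := e
  obtain ⟨t', s'⟩ := e'
  obtain ⟨t'', s''⟩ := e''
  simp only [vertex, partialXi_partialXi, List.map_cons, List.map_nil, List.prod_cons,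
    List.prod_nil, mul_one, partialU_smul, partialU_one, smul_zero, add_zero,
    derivation_sgn_mul, coordU_monomial, derivation_half, Module.End.mul_apply]
  by_cases hs'' : s'' = 0
  · by_cases hs' : s' = 0
    · have h1 : (coordU 0).derivation (4 * half * u 0 ^ 3) = 12 * half * u 0 ^ 2 := by
        rw [coordU_monomial _ 2 _ (by simp)]; norm_num; ring
      by_cases hs : s = 0
      · subst hs hs' hs''
        have : (coordU 0).derivation (12 * half * u 0 ^ 2) = 24 * half * u 0 := by
          rw [coordU_monomial _ 1 _ (by simp)]; norm_num; ring
        norm_num [this, h1, totalD_pow_smul_one, iterate_sgn_mul, ← Function.iterate_add_apply,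
          add_assoc]
      · have : (coordU s).derivation (12 * half * u 0 ^ 2) = 0 := by
          rw [coordU_monomial _ 1 _ (by simp), if_neg hs]
        subst hs' hs''
        norm_num [this, h1, hs]
    · have : (coordU s').derivation (4 * half * u 0 ^ 3) = 0 := by
        rw [coordU_monomial _ 2 _ (by simp), if_neg hs']
      norm_num [this, hs', hs'']
  · simp [hs'']

lemma vertex_one_ne_zero {a b : ℕ} {e : ℕ × ℕ}
    (h : vertex ((half * u 0 ^ 4) • (ξ 0 * ξ 1)) a b [e] ≠ 0) : sgn a b ≠ 0 ∧ e.2 = 0 := by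
  rw [vertex_one] at h
  constructor
  · intro h0; simp [h0] at h
  · by_contra hn; simp [hn] at h

lemma vertex_two_ne_zero {a b : ℕ} {e e' : ℕ × ℕ}
    (h : vertex ((half * u 0 ^ 4) • (ξ 0 * ξ 1)) a b [e, e'] ≠ 0) :
    sgn a b ≠ 0 ∧ e.2 = 0 ∧ e'.2 = 0 := by
  rw [vertex_two] at h
  constructor
  · intro h0; simp [h0] at h
  · by_contra hn; simp [hn] at h

lemma vertex_three_ne_zero {a b : ℕ} {e e' e'' : ℕ × ℕ}
    (h : vertex ((half * u 0 ^ 4) • (ξ 0 * ξ 1)) a b [e, e', e''] ≠ 0) :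
    sgn a b ≠ 0 ∧ e.2 = 0 ∧ e'.2 = 0 ∧ e''.2 = 0 := by
  rw [vertex_three] at h
  constructor
  · intro h0; simp [h0] at h
  · by_contra hn; simp [hn] at h

lemma sgn_zero_one : sgn 0 1 = 1 := by simp [sgn]
lemma sgn_one_zero : sgn 1 0 = -1 := by simp [sgn]

/-! ### Evaluation of the two flows at P₀ -/

lemma derivation_pow (X : JetField) (f : LocalFun) (n : ℕ) :
    X.derivation (f ^ n) = n * f ^ (n - 1) * X.derivation f := by
  simp [Derivation.leibniz_pow, mul_assoc]

/-- With R = u³ the sum over k, l, m is, up to a constant, the binomial expression uR'³ - 3u'R'²R +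
3u''R'R² - u'''R³. Its two terms in u⁷u_x³ cancel, and 9u⁸u_xu_xx - u⁹u_xxx remains. -/
lemma flow₁_eq : flow₁ ((half * u 0 ^ 4) • (ξ 0 * ξ 1)) =
    (half * (192 * (9 * u 0 ^ 8 * u 1 * u 2 - u 0 ^ 9 * u 3))) • (ξ 0 * ξ 1) := by
  unfold flow₁
  rw [finsum_flow₁]
  · simp only [Finset.sum_range_succ, Finset.sum_range_zero, zero_add, sum_decorations,
      vertex_one, vertex_three, Nat.sub_zero, Nat.sub_self, sgn_zero_one, sgn_one_zero, and_self,
      if_true, Nat.reduceAdd, one_mul, ξ_mul_swap 1 0,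
      smul_neg, neg_mul, mul_neg, neg_neg, ← add_smul, ← neg_smul, real_smul_eq,
      smul_smul, smul_mul_assoc, Function.iterate_succ, Function.iterate_zero, Function.comp,
      id, derivation_half, derivation_ofNat, Derivation.leibniz, derivation_pow, cartan_u,
      smul_eq_mul, mul_zero, add_zero]
    -- Each of the four vertices contributes one `half`. The cofactor comes from 16h⁴ - 1 = (2h -
    -- 1)(8h³ + 4h² + 2h + 1).
    have h5 : half ^ 4 * 16 = 1 := by
      linear_combination (8 * half ^ 3 + 4 * half ^ 2 + 2 * half + 1) * two_mul_half
    norm_num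
    rw [← half]
    congr 1
    linear_combination half * 192 * (9 * u 0 ^ 8 * u 1 * u 2 - u 0 ^ 9 * u 3) * h5
  · intro i j k l m k' l' m' h
    -- A nonzero product has nonzero vertices: each gives σ = 0 for its incoming edges and tails {0,
    -- 1} for its outgoing ones.
    have h1 := vertex_three_ne_zero (left_ne_zero_of_mul (left_ne_zero_of_mul
      (left_ne_zero_of_mul (left_ne_zero_of_mul h))))
    have h2 := vertex_one_ne_zero (right_ne_zero_of_mul (left_ne_zero_of_mul
      (left_ne_zero_of_mul (left_ne_zero_of_mul h))))
    have h3 := vertex_one_ne_zero (right_ne_zero_of_mul (left_ne_zero_of_mul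
      (left_ne_zero_of_mul h)))
    have h4 := vertex_one_ne_zero (right_ne_zero_of_mul (left_ne_zero_of_mul h))
    have g1 := sgn_ne_zero h1.1
    have g2 := sgn_ne_zero h2.1
    have g3 := sgn_ne_zero h3.1
    have g4 := sgn_ne_zero h4.1
    simp only [mem_decorations, Prod.ext_iff]
    omega

/-- With Q = 6u² and R = 2u³, the terms (i,m) = (0,1) and (1,0) both have coefficient RR'(Q'² -
QQ''). A symmetric coefficient is killed by the anticommuting ξ's. -/
lemma flow₂_eq : flow₂ ((half * u 0 ^ 4) • (ξ 0 * ξ 1)) = 0 := by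
  unfold flow₂
  rw [finsum_flow₂]
  · simp only [Finset.sum_range_succ, Finset.sum_range_zero, zero_add, sum_decorations,
      vertex_one, vertex_two, Nat.sub_zero, Nat.sub_self, sgn_zero_one, sgn_one_zero, and_self,
      if_true, Nat.reduceAdd, one_mul, ξ_mul_swap 1 0, ξ_sq,
      smul_zero, smul_neg, neg_mul, neg_neg, ← neg_smul,
      smul_mul_assoc, Function.iterate_succ, Function.iterate_zero, Function.comp,
      id, derivation_half, derivation_ofNat, Derivation.leibniz, derivation_pow, cartan_u,
      smul_eq_mul, mul_zero, add_zero]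
    module
  · intro i m j k l k' l' m' h
    have h1 := vertex_two_ne_zero (left_ne_zero_of_mul (left_ne_zero_of_mul
      (left_ne_zero_of_mul (left_ne_zero_of_mul h))))
    have h2 := vertex_two_ne_zero (right_ne_zero_of_mul (left_ne_zero_of_mul
      (left_ne_zero_of_mul (left_ne_zero_of_mul h))))
    have h3 := vertex_one_ne_zero (right_ne_zero_of_mul (left_ne_zero_of_mul
      (left_ne_zero_of_mul h)))
    have h4 := vertex_one_ne_zero (right_ne_zero_of_mul (left_ne_zero_of_mul h))
    have g1 := sgn_ne_zero h1.1
    have g2 := sgn_ne_zero h2.1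
    have g3 := sgn_ne_zero h3.1
    have g4 := sgn_ne_zero h4.1
    simp only [mem_decorations, Prod.ext_iff]
    omega

/-! ### Skew-adjointness, Schouten brackets and the obstruction -/

lemma cohomologous_zero (F : Density) (h : F = 0) : Cohomologous F 0 := ⟨0, by simp [h]⟩

lemma harryDym_skew (f g : LocalFun) :
    Cohomologous (ofFun f * harryDym (ofFun g) + harryDym (ofFun f) * ofFun g) 0 := by
  refine ⟨ofFun (u 0 ^ 2 * f * (u 0 ^ 2 * g)), ?_⟩
  simp only [harryDym, Module.End.mul_apply, mulOp, LinearMap.mulLeft_apply, ← map_mul,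
    totalD_ofFun, ← map_add, sub_zero, Derivation.leibniz, smul_eq_mul]
  congr 1
  ring

lemma euler_partialXi_bivec (g : LocalFun) : euler partialXi (g • (ξ 0 * ξ 1)) =
    (2 * g) • ξ 1 + cartan.derivation g • ξ 0 := by
  rw [euler_eq_sum _ _ 2]
  · simp only [Finset.sum_range_succ, Finset.sum_range_zero, zero_add, partialXi_smul,
      partialXi_ξ_mul, partialXi_ξ, pow_zero, pow_one, Module.End.one_apply, one_smul]
    simp [totalD_smul]
    module
  · intro k hk
    simp [partialXi_smul, partialXi_ξ_mul, show k ≠ 0 by omega, show k ≠ 1 by omega]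

/-- In degree two, a right derivative differs from the left one by a single transposition, hence by
the sign. -/
lemma euler_partialXiRight_bivec (g : LocalFun) : euler partialXiRight (g • (ξ 0 * ξ 1)) =
    -((2 * g) • ξ 1 + cartan.derivation g • ξ 0) := by
  rw [euler_eq_sum _ _ 2]
  · simp only [Finset.sum_range_succ, Finset.sum_range_zero, zero_add, partialXiRight_smul,
      partialXiRight_mul_ξ, partialXiRight_ξ, pow_zero, pow_one, Module.End.one_apply, one_smul]
    simp [totalD_smul]
    module
  · intro k hk
    simp [partialXiRight_smul, partialXiRight_mul_ξ, show k ≠ 0 by omega, show k ≠ 1 by omega]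

lemma euler_partialU_harryDym : euler partialU ((half * u 0 ^ 4) • (ξ 0 * ξ 1)) =
    (4 * half * u 0 ^ 3) • (ξ 0 * ξ 1) := by
  rw [euler_eq_sum _ _ 1]
  · simp [partialU_smul]
    congr 1
    ring
  · intro k hk
    simp [partialU_smul, show k ≠ 0 by omega]

lemma ξ_mul_ξ_mul_self (j k : ℕ) : ξ j * (ξ k * ξ j) = 0 := by
  rw [ξ_mul_swap k j, mul_neg, ← mul_assoc, ξ_sq, zero_mul, neg_zero]

lemma ξ_self_mul (j k : ℕ) : ξ j * (ξ j * ξ k) = 0 := by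
  rw [← mul_assoc, ξ_sq, zero_mul]

/-- The bracket of `P₀` with a bivector `g ξ ξ_x`. -/
lemma schouten_harryDym (g : LocalFun) :
    schouten ((half * u 0 ^ 4) • (ξ 0 * ξ 1)) (g • (ξ 0 * ξ 1)) =
      (u 0 ^ 4 • ξ 1 + (2 * u 0 ^ 3 * u 1) • ξ 0) * euler partialU (g • (ξ 0 * ξ 1)) := by
  have h1 : (2 * (half * u 0 ^ 4)) = u 0 ^ 4 := by linear_combination u 0 ^ 4 * two_mul_half
  have h2 : cartan.derivation (half * u 0 ^ 4) = 2 * u 0 ^ 3 * u 1 := by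
    simp
    linear_combination 2 * u 0 ^ 3 * u 1 * two_mul_half
  rw [schouten, euler_partialU_harryDym, euler_partialXi_bivec, euler_partialXiRight_bivec, h1, h2]
  -- The first product of the bracket vanishes: a multiple of ξξ₁ meets a combination of ξ and ξ₁.
  simp only [mul_add, smul_mul_smul_comm, mul_assoc, ξ_sq, mul_zero, smul_zero, zero_add, neg_mul,
    sub_neg_eq_add, ξ_mul_ξ_mul_self]

lemma schouten_harryDym_self :
    schouten ((half * u 0 ^ 4) • (ξ 0 * ξ 1)) ((half * u 0 ^ 4) • (ξ 0 * ξ 1)) = 0 := by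
  rw [schouten_harryDym, euler_partialU_harryDym]
  simp only [add_mul, smul_mul_smul_comm, ξ_self_mul, ξ_mul_ξ_mul_self, smul_zero, add_zero]

/-- The only contribution of the highest order to the variational derivative of a trivector. -/
lemma partialXi_partialXi_euler (a b c : LocalFun) :
    partialXi 5 (partialXi 0 (euler partialXi (a • (ξ 0 * (ξ 1 * ξ 2)) + b • (ξ 0 * (ξ 1 * ξ 3)) +
      c • (ξ 0 * (ξ 1 * ξ 4))))) = (2 * c) • (1 : Density) := by
  rw [euler_eq_sum _ _ 5]
  -- The terms k = 1 and k = 4, namely -D(-c ξξ₄) and D⁴(c ξξ₁), each contribute c to the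
  -- coefficient of ξξ₅. The terms in `a` and `b` reach at most ξ₄.
  · simp [Finset.sum_range_succ, partialXi_smul, partialXi_ξ_mul, pow_succ, totalD_smul,
      totalD_mul, mul_sub]
    module
  · intro k hk
    simp [partialXi_smul, partialXi_ξ_mul, show k ≠ 0 by omega, show k ≠ 1 by omega,
      show k ≠ 2 by omega, show k ≠ 3 by omega, show k ≠ 4 by omega]

/-- The coefficients of ξξ₄ and ξ₁ξ₃ come solely from -D³ applied to ξξ₁. The remaining ones do not
affect the obstruction and stay anonymous. -/
lemma euler_partialU_bivec (g : LocalFun) (hg : ∀ k, 4 ≤ k → (coordU k).derivation g = 0) :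
    ∃ a b c d : LocalFun, euler partialU (g • (ξ 0 * ξ 1)) =
      a • (ξ 0 * ξ 1) + b • (ξ 0 * ξ 2) + c • (ξ 0 * ξ 3) - (coordU 3).derivation g • (ξ 0 * ξ 4) +
      d • (ξ 1 * ξ 2) - (2 * (coordU 3).derivation g) • (ξ 1 * ξ 3) := by
  generalize hD : (fun f => cartan.derivation f) = D
  -- Leibniz expansion of ∑(-D)^k(∂g/∂u_k · ξξ₁), with D(ξξ₁) = ξξ₂, D²(ξξ₁) = ξξ₃ + ξ₁ξ₂ and
  -- D³(ξξ₁) = ξξ₄ + 2ξ₁ξ₃.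
  refine ⟨(coordU 0).derivation g - D ((coordU 1).derivation g) + D (D ((coordU 2).derivation g))
    - D (D (D ((coordU 3).derivation g))), - (coordU 1).derivation g +
    2 * D ((coordU 2).derivation g) - 3 * D (D ((coordU 3).derivation g)),
    (coordU 2).derivation g - 3 * D ((coordU 3).derivation g),
    (coordU 2).derivation g - 3 * D ((coordU 3).derivation g), ?_⟩
  subst hD
  rw [euler_eq_sum _ _ 4]
  · simp [Finset.sum_range_succ, partialU_smul, pow_succ, totalD_smul, totalD_mul, ξ_sq]
    module
  · intro k hk
    simp [partialU_smul, hg k hk]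

/-- The augmentation of the Grassmann algebra, which sends every ξ_k to 0, recovers `f` from `f •
1`. -/
lemma smul_one_ne_zero {f : LocalFun} {p : Jet} (h : f.1 p ≠ 0) : f • (1 : Density) ≠ 0 := by
  intro hf
  have := congrArg ((TensorProduct.rid ℝ LocalFun) ∘ (LinearMap.lTensor LocalFun
    (ExteriorAlgebra.algebraMapInv (R := ℝ) (M := ℕ →₀ ℝ)).toLinearMap)) hf
  simp [Algebra.TensorProduct.one_def, TensorProduct.smul_tmul'] at this
  exact h (congrArg (fun f : LocalFun => f.1 p) this)

/-- The bracket of `P₀` with a bivector of order three is not a total derivative unless its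
symbol vanishes. -/
lemma schouten_harryDym_not_cohomologous (g : LocalFun)
    (hg : ∀ k, 4 ≤ k → (coordU k).derivation g = 0) {p : Jet}
    (hp : (u 0 ^ 4 * (coordU 3).derivation g).1 p ≠ 0) :
    ¬ Cohomologous (schouten ((half * u 0 ^ 4) • (ξ 0 * ξ 1)) (g • (ξ 0 * ξ 1))) 0 := by
  rintro ⟨η, hη⟩
  obtain ⟨a, b, c, d, h⟩ := euler_partialU_bivec g hg
  have key : schouten ((half * u 0 ^ 4) • (ξ 0 * ξ 1)) (g • (ξ 0 * ξ 1)) =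
      (2 * u 0 ^ 3 * u 1 * d - u 0 ^ 4 * b) • (ξ 0 * (ξ 1 * ξ 2)) +
      (-(u 0 ^ 4 * c) - 4 * u 0 ^ 3 * u 1 * (coordU 3).derivation g) • (ξ 0 * (ξ 1 * ξ 3)) +
      (u 0 ^ 4 * (coordU 3).derivation g) • (ξ 0 * (ξ 1 * ξ 4)) := by
    have hs : ∀ k, ξ 1 * (ξ 0 * ξ k) = -(ξ 0 * (ξ 1 * ξ k)) := fun k => by
      rw [← mul_assoc, ξ_mul_swap 1 0, neg_mul, mul_assoc]
    rw [schouten_harryDym, h]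
    simp only [add_mul, mul_add, mul_sub, smul_mul_smul_comm, ξ_self_mul, hs, ξ_sq, mul_zero,
      smul_zero, neg_zero]
    module
  have h0 := partialXi_partialXi_euler (2 * u 0 ^ 3 * u 1 * d - u 0 ^ 4 * b)
    (-(u 0 ^ 4 * c) - 4 * u 0 ^ 3 * u 1 * (coordU 3).derivation g)
    (u 0 ^ 4 * (coordU 3).derivation g)
  rw [← key, ← sub_zero (schouten _ _), hη, euler_partialXi_totalD, map_zero, map_zero] at h0
  refine smul_one_ne_zero (f := 2 * _) (p := p) (mul_ne_zero (two_ne_zero' ℝ) hp) ?_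
  exact h0.symm

lemma flow_symbol : (coordU 3).derivation
    (half * (192 * (9 * u 0 ^ 8 * u 1 * u 2 - u 0 ^ 9 * u 3))) = -96 * u 0 ^ 9 := by
  simp
  linear_combination 96 * u 0 ^ 9 * two_mul_half

end HarryDym

end

theorem mainTheorem5 :
    HarryDym.IsHamiltonian HarryDym.harryDym ∧
    HarryDym.flow₁ (HarryDym.bivector HarryDym.harryDym) =
      HarryDym.bivector
        (HarryDym.mulOp (192 * (9 * HarryDym.u 0 ^ 8 * HarryDym.u 1 * HarryDym.u 2
          - HarryDym.u 0 ^ 9 * HarryDym.u 3)) * HarryDym.totalD) ∧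
    ¬ HarryDym.Cohomologous
      (HarryDym.schouten (HarryDym.bivector HarryDym.harryDym)
        (HarryDym.flow₁ (HarryDym.bivector HarryDym.harryDym))) 0 ∧
    HarryDym.Cohomologous (HarryDym.flow₂ (HarryDym.bivector HarryDym.harryDym)) 0 := by
  open HarryDym in
  rw [IsHamiltonian, bivector_harryDym, bivector_mulOp, flow₁_eq, flow₂_eq, schouten_harryDym_self]
  refine ⟨⟨harryDym_skew, cohomologous_zero _ rfl⟩, rfl, ?_, cohomologous_zero _ rfl⟩
  -- Any jet with u ≠ 0 would do; at this one -96u¹³ equals -96.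
  refine schouten_harryDym_not_cohomologous _ (fun k hk => ?_) (p := (0, fun _ => 1)) ?_
  · simp [show k ≠ 0 by omega, show k ≠ 1 by omega, show k ≠ 2 by omega,
      show k ≠ 3 by omega]
  · rw [flow_symbol]
    change LocalFun.toFun (u 0 ^ 4 * (-96 * u 0 ^ 9)) _ ≠ 0
    have hu : LocalFun.toFun (u 0) (0, fun _ => 1) = 1 := rfl
    simp [hu, map_ofNat]
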